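/- A graph $\Gamma$ consists of a set of vertices and a set of oriented edges, each with an origin and a terminus, together with an involution $e\mapsto e^{-1}$ on the oriented edges exchanging origin and terminus; loops and multiple edges are allowed, and a loop may or may not equal its own inverse. $\Gamma$ is $d$-regular if every vertex is the origin of exactly $d$ oriented edges. A path of length $n$ is a sequence of $n$ oriented edges in which each edge starts where the preceding one ends (for $n=0$, a single vertex); it is reduced if no edge $e$ in it is immediately followed by $e^{-1}$. Theorem 5.7. Let $d\ge 3$, let $\Gamma$ be a connected $d$-regular graph with infinitely many vertices, and let $x_0$ be any vertex of $\Gamma$. For $n\ge 0$ let $a_n$ be the number of reduced paths of length $n$ from $x_0$ to $x_0$, $b_n$ the number of all paths of length $n$ from $x_0$ to $x_0$, $r_n$ the number of reduced paths of length at most $n$ from $x_0$ to $x_0$, and $z_n$ the number of all paths of length at most $n$ from $x_0$ to $x_0$. Then (i) $\displaystyle\lim_{n\to\infty}\frac{a_n}{(d-1)^n}=\lim_{n\to\infty}\frac{b_n}{d^n}=0$; (ii) $\displaystyle\lim_{n\to\infty}\frac{r_n}{(d-1)^n}=\lim_{n\to\infty}\frac{z_n}{d^n}=0.$ -/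

import Mathlib

/-!
A graph, with loops and multiple edges allowed, is given by oriented edges and a formal reversal:
a vertex type `V` with `[Quiver V] [Quiver.HasInvolutiveReverse V]`. An arrow `e : x ⟶ y` is an
oriented edge from `x` to `y`, and `Quiver.reverse e : y ⟶ x` is the same edge traversed backwards.
A loop may or may not be equal to its own reverse; in the first case it contributes one to the
degree of its vertex, in the second case two. An edge-path is a `Quiver.Path`, its length is
`Quiver.Path.length`.
-/

namespace GraphPaths

universe u v

variable {V : Type u} [Quiver.{v} V]

/-- Every two vertices are joined by an edge-path. (As every edge can be traversed in both
directions, this is the connectedness of the underlying undirected graph.) -/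
def Connected (V : Type u) [Quiver.{v} V] : Prop :=
  ∀ x y : V, Nonempty (Quiver.Path x y)

/-- Every vertex is the origin of exactly `d` oriented edges. For `d ≠ 0` this includes that
the set of these edges is finite. -/
def RegularOfDegree (V : Type u) [Quiver.{v} V] (d : ℕ) : Prop :=
  ∀ x : V, Nat.card (Quiver.Star x) = d

/-- A path is reduced (has no backtracks) if no edge of it is directly followed by its reverse.
Successive edges `e : b ⟶ c` and `f : c ⟶ d` are compared as edges with origin `c`. -/
def IsReducedPath [Quiver.HasReverse V] {x : V} : ∀ {y : V}, Quiver.Path x y → Prop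
  | _, .nil => True
  | _, .cons .nil _ => True
  | _, .cons (.cons p e) f =>
      IsReducedPath (.cons p e) ∧ Quiver.Star.mk f ≠ Quiver.Star.mk (Quiver.reverse e)

/-- `a_n`: the number of reduced paths of length `n` from `x₀` to `x₀`. -/
noncomputable def numReducedClosed [Quiver.HasReverse V] (x₀ : V) (n : ℕ) : ℕ :=
  Nat.card {p : Quiver.Path x₀ x₀ // IsReducedPath p ∧ p.length = n}

/-- `b_n`: the number of all paths of length `n` from `x₀` to `x₀`. -/
noncomputable def numClosed (x₀ : V) (n : ℕ) : ℕ :=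
  Nat.card {p : Quiver.Path x₀ x₀ // p.length = n}

/-- `r_n`: the number of reduced paths of length at most `n` from `x₀` to `x₀`. -/
noncomputable def numReducedClosedLE [Quiver.HasReverse V] (x₀ : V) (n : ℕ) : ℕ :=
  Nat.card {p : Quiver.Path x₀ x₀ // IsReducedPath p ∧ p.length ≤ n}

/-- `z_n`: the number of all paths of length at most `n` from `x₀` to `x₀`. -/
noncomputable def numClosedLE (x₀ : V) (n : ℕ) : ℕ :=
  Nat.card {p : Quiver.Path x₀ x₀ // p.length ≤ n}

end GraphPaths

/-!
Both counts are driven by a rule saying which oriented edge may follow which: any composable edge,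
respectively any composable edge except the reverse. Up to normalisation, the number of admissible
paths with a given last edge evolves by averaging over the predecessors of that edge. Every edge has
the same number of successors as of predecessors, so averaging does not increase the `ℓ²` norm, and
the norm it loses controls the variation of the weights along the rule. Since the norms converge,
the weights of an edge at time `n` and of its successors at time `n + 1` become equal in the limit.
Two edges with the same terminus have a common successor; moving along a path of the graph by
successors, and by predecessors of reversed edges, shows that every edge weighs asymptotically, at
time `n` or at time `n + 1`, the same as a given edge at time `n`. There are infinitely many edges
and the norm is bounded, so the weights tend to `0`.
-/

open Filter Topology

namespace GraphPaths

section Biregular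

variable {E : Type*} {R : E → E → Prop} {k : ℕ}

/-- The relation `R` is `k`-biregular, with `0 < k`: every element has exactly `k` successors and
exactly `k` predecessors. -/
structure IsBiregular (R : E → E → Prop) (k : ℕ) : Prop where
  pos : 0 < k
  card_succ : ∀ e, Nat.card {f // R e f} = k
  card_pred : ∀ f, Nat.card {e // R e f} = k

/-- The averaging operator of `R`: the mean of `g` over the `R`-predecessors of `f`. It has its
meaning when these are finite and nonzero in number. -/
noncomputable def predMean (R : E → E → Prop) (g : E → ℝ) (f : E) : ℝ :=
  (∑' e : {e // R e f}, g e) / Nat.card {e // R e f}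

namespace IsBiregular

theorem finite_succ (h : IsBiregular R k) (e : E) : Finite {f // R e f} :=
  Nat.finite_of_card_ne_zero (h.card_succ e ▸ h.pos.ne')

theorem finite_pred (h : IsBiregular R k) (f : E) : Finite {e // R e f} :=
  Nat.finite_of_card_ne_zero (h.card_pred f ▸ h.pos.ne')

theorem exists_pred (h : IsBiregular R k) (f : E) : ∃ e, R e f := by
  have : 0 < Nat.card {e // R e f} := h.card_pred f ▸ h.pos
  exact nonempty_subtype.1 (Nat.card_pos_iff.1 this).1

theorem mul_predMean (h : IsBiregular R k) (g : E → ℝ) (f : E) :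
    k * predMean R g f = ∑' e : {e // R e f}, g e := by
  rw [predMean, h.card_pred, mul_div_cancel₀ _ (Nat.cast_ne_zero.2 h.pos.ne')]

theorem hasSum_tsum_pred (h : IsBiregular R k) {g : E → ℝ} (hg : Summable g) :
    HasSum (fun f => ∑' e : {e // R e f}, g e) (k * ∑' e, g e) := by
  have tsum_succ (g : E → ℝ) (e : E) : ∑' _ : {f // R e f}, g e = k * g e := by
    rw [tsum_const, h.card_succ, nsmul_eq_mul]
  have summable_succ : Summable fun x : Σ e, {f // R e f} => g x.1 := by
    refine Summable.of_abs ((summable_sigma_of_nonneg fun _ => abs_nonneg _).2 ⟨fun e => ?_, ?_⟩)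
    · have := h.finite_succ e
      exact Summable.of_finite
    · simpa only [tsum_succ fun e => |g e|] using hg.abs.mul_left (k : ℝ)
  let swap : (Σ f, {e // R e f}) ≃ Σ e, {f // R e f} :=
    ⟨fun x => ⟨x.2, x.1, x.2.2⟩, fun x => ⟨x.2, x.1, x.2.2⟩, fun _ => rfl, fun _ => rfl⟩
  have summable_pred : Summable fun x : Σ f, {e // R e f} => g x.2 :=
    swap.summable_iff.2 summable_succ
  have tsum_pred : ∑' x : Σ f, {e // R e f}, g x.2 = k * ∑' e, g e := by
    rw [← tsum_mul_left, ← tsum_congr (tsum_succ g), ← summable_succ.tsum_sigma]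
    exact swap.tsum_eq fun x : Σ e, {f // R e f} => g x.1
  rw [← tsum_pred, summable_pred.tsum_sigma]
  exact summable_pred.sigma.hasSum

theorem tsum_pred_sq_sub_predMean (h : IsBiregular R k) (g : E → ℝ) (f : E) :
    ∑' e : {e // R e f}, (g e - predMean R g f) ^ 2 =
      (∑' e : {e // R e f}, g e ^ 2) - k * predMean R g f ^ 2 := by
  have := h.finite_pred f
  have := Fintype.ofFinite {e // R e f}
  have hsum : ∑ e : {e // R e f}, g e = k * predMean R g f := by
    rw [h.mul_predMean, tsum_fintype]
  have hcard : (Finset.univ : Finset {e // R e f}).card = k := by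
    rw [Finset.card_univ, ← Nat.card_eq_fintype_card, h.card_pred]
  simp only [tsum_fintype, sub_sq, Finset.sum_add_distrib, Finset.sum_sub_distrib,
    ← Finset.sum_mul, ← Finset.mul_sum, hsum, Finset.sum_const, hcard, nsmul_eq_mul]
  ring

variable {g : E → ℝ}

theorem summable_sq_predMean (h : IsBiregular R k) (hg : Summable fun e => g e ^ 2) :
    Summable fun f => predMean R g f ^ 2 := by
  refine .of_nonneg_of_le (fun _ => sq_nonneg _) (fun f => ?_) (h.hasSum_tsum_pred hg).summable
  have hvar : 0 ≤ ∑' e : {e // R e f}, (g e - predMean R g f) ^ 2 :=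
    tsum_nonneg fun _ => sq_nonneg _
  rw [h.tsum_pred_sq_sub_predMean, sub_nonneg] at hvar
  exact (le_mul_of_one_le_left (sq_nonneg _) (Nat.one_le_cast.2 h.pos)).trans hvar

theorem hasSum_sq_sub_predMean (h : IsBiregular R k) (hg : Summable fun e => g e ^ 2) :
    HasSum (fun f => ∑' e : {e // R e f}, (g e - predMean R g f) ^ 2)
      (k * (∑' e, g e ^ 2 - ∑' f, predMean R g f ^ 2)) := by
  simp only [h.tsum_pred_sq_sub_predMean, mul_sub]
  exact (h.hasSum_tsum_pred hg).sub ((h.summable_sq_predMean hg).hasSum.mul_left (k : ℝ))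

theorem tsum_sq_predMean_le (h : IsBiregular R k) (hg : Summable fun e => g e ^ 2) :
    ∑' f, predMean R g f ^ 2 ≤ ∑' e, g e ^ 2 := by
  have hnonneg := (h.hasSum_sq_sub_predMean hg).nonneg fun _ => tsum_nonneg fun _ => sq_nonneg _
  exact sub_nonneg.1 (nonneg_of_mul_nonneg_right hnonneg (Nat.cast_pos.2 h.pos))

theorem sq_sub_predMean_le (h : IsBiregular R k) (hg : Summable fun e => g e ^ 2) {e f : E}
    (hef : R e f) :
    (g e - predMean R g f) ^ 2 ≤ k * (∑' e, g e ^ 2 - ∑' f, predMean R g f ^ 2) := by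
  have := h.finite_pred f
  calc (g e - predMean R g f) ^ 2
      ≤ ∑' e : {e // R e f}, (g e - predMean R g f) ^ 2 :=
        (Summable.of_finite (f := fun e : {e // R e f} => (g e - predMean R g f) ^ 2)).le_tsum
          ⟨e, hef⟩ fun _ _ => sq_nonneg _
    _ ≤ k * (∑' e, g e ^ 2 - ∑' f, predMean R g f ^ 2) :=
        le_hasSum (h.hasSum_sq_sub_predMean hg) f fun _ _ => tsum_nonneg fun _ => sq_nonneg _

theorem summable_sq_iterate_predMean (h : IsBiregular R k) (hg : Summable fun e => g e ^ 2)
    (n : ℕ) : Summable fun e => (predMean R)^[n] g e ^ 2 := by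
  induction n with
  | zero => exact hg
  | succ n ih => simpa only [Function.iterate_succ_apply'] using h.summable_sq_predMean ih

theorem antitone_tsum_sq_iterate_predMean (h : IsBiregular R k)
    (hg : Summable fun e => g e ^ 2) :
    Antitone fun n => ∑' e, (predMean R)^[n] g e ^ 2 :=
  antitone_nat_of_succ_le fun n => by
    simpa only [Function.iterate_succ_apply'] using
      h.tsum_sq_predMean_le (h.summable_sq_iterate_predMean hg n)

theorem tendsto_iterate_predMean_sub (h : IsBiregular R k) (hg : Summable fun e => g e ^ 2)
    {e f : E} (hef : R e f) :
    Tendsto (fun n => (predMean R)^[n] g e - (predMean R)^[n + 1] g f) atTop (𝓝 0) := by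
  set Q : ℕ → ℝ := fun n => ∑' e, (predMean R)^[n] g e ^ 2
  have hQ : Tendsto Q atTop (𝓝 (⨅ n, Q n)) :=
    tendsto_atTop_ciInf (h.antitone_tsum_sq_iterate_predMean hg)
      ⟨0, Set.forall_mem_range.2 fun _ => tsum_nonneg fun _ => sq_nonneg _⟩
  have hloss : Tendsto (fun n => k * (Q n - Q (n + 1))) atTop (𝓝 0) := by
    simpa using (hQ.sub (hQ.comp (tendsto_add_atTop_nat 1))).const_mul (k : ℝ)
  have hle (n : ℕ) : ((predMean R)^[n] g e - (predMean R)^[n + 1] g f) ^ 2 ≤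
      k * (Q n - Q (n + 1)) := by
    simp only [Q, Function.iterate_succ_apply']
    exact h.sq_sub_predMean_le (h.summable_sq_iterate_predMean hg n) hef
  exact squeeze_zero_norm (fun n => Real.abs_le_sqrt (hle n)) (by simpa using hloss.sqrt)

end IsBiregular

end Biregular

section Limits

theorem tendsto_zero_of_infinite_tendsto_sub {ι E : Type*} {l : Filter ι} {a : ι → ℝ}
    {u : ι → E → ℝ} {C : ℝ} (hu : ∀ i (t : Finset E), ∑ e ∈ t, u i e ^ 2 ≤ C)
    (hinf : {e | Tendsto (fun i => a i - u i e) l (𝓝 0)}.Infinite) : Tendsto a l (𝓝 0) := by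
  rw [Metric.tendsto_nhds]
  intro ε hε
  obtain ⟨M, hM⟩ := exists_nat_gt ((2 * C + 1) / ε ^ 2)
  rw [div_lt_iff₀ (by positivity)] at hM
  obtain ⟨t, ht, hcard⟩ := hinf.exists_subset_card_eq M
  have hdiff : Tendsto (fun i => ∑ e ∈ t, 2 * (a i - u i e) ^ 2) l (𝓝 0) := by
    simpa using tendsto_finsetSum t fun e he => ((ht he).pow 2).const_mul 2
  filter_upwards [hdiff.eventually_lt_const one_pos] with i hi
  have hsum : M * a i ^ 2 ≤ 2 * C + 1 :=
    calc M * a i ^ 2 = ∑ e ∈ t, a i ^ 2 := by rw [Finset.sum_const, hcard, nsmul_eq_mul]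
      _ ≤ ∑ e ∈ t, (2 * u i e ^ 2 + 2 * (a i - u i e) ^ 2) :=
        Finset.sum_le_sum fun e _ => by nlinarith [sq_nonneg (a i - 2 * u i e)]
      _ = 2 * ∑ e ∈ t, u i e ^ 2 + ∑ e ∈ t, 2 * (a i - u i e) ^ 2 := by
        rw [Finset.sum_add_distrib, Finset.mul_sum]
      _ ≤ 2 * C + 1 := by linarith [hu i t]
  rw [Real.dist_0_eq_abs]
  exact abs_lt_of_sq_lt_sq (lt_of_mul_lt_mul_left (hsum.trans_lt hM) M.cast_nonneg) hε.le

theorem tendsto_sum_range_div_pow {a : ℕ → ℝ} {q : ℝ} (hq : 1 < q)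
    (ha : Tendsto (fun n => a n / q ^ n) atTop (𝓝 0)) :
    Tendsto (fun n => (∑ i ∈ Finset.range (n + 1), a i) / q ^ n) atTop (𝓝 0) := by
  have hq0 : 0 < q := one_pos.trans hq
  have hpow (n : ℕ) : q ^ n ≠ 0 := (pow_pos hq0 n).ne'
  have hlittle : a =o[atTop] fun n => q ^ n :=
    (Asymptotics.isLittleO_iff_tendsto fun n hn => (hpow n hn).elim).2 ha
  have hgeom_atTop : Tendsto (fun n => ∑ i ∈ Finset.range n, q ^ i) atTop atTop := by
    refine tendsto_atTop_mono (fun n => ?_) tendsto_natCast_atTop_atTop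
    calc (n : ℝ) = ∑ i ∈ Finset.range n, 1 := by simp
      _ ≤ ∑ i ∈ Finset.range n, q ^ i := Finset.sum_le_sum fun i _ => one_le_pow₀ hq.le
  have hgeom : (fun n => ∑ i ∈ Finset.range (n + 1), q ^ i) =O[atTop] fun n => q ^ n := by
    refine .of_bound (q / (q - 1)) (.of_forall fun n => ?_)
    rw [Real.norm_of_nonneg (Finset.sum_nonneg fun i _ => (pow_pos hq0 i).le),
      Real.norm_of_nonneg (pow_pos hq0 n).le, geom_sum_eq hq.ne', div_mul_eq_mul_div, ← pow_succ']
    gcongr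
    exact sub_le_self _ zero_le_one
  refine (Asymptotics.isLittleO_iff_tendsto fun n hn => (hpow n hn).elim).1 ?_
  exact ((hlittle.sum_range (fun n => (pow_pos hq0 n).le) hgeom_atTop).comp_tendsto
    (tendsto_add_atTop_nat 1)).trans_isBigO hgeom

end Limits

universe u v

variable {V : Type u} [Quiver.{v} V]

section Edges

/-- An edge with prescribed terminus `y`, as an element of the type of all oriented edges. -/
def costarEdge {y : V} (s : Quiver.Costar y) : Quiver.Total V := ⟨s.1, y, s.2⟩

theorem costarEdge_injective (y : V) : Function.Injective (costarEdge (y := y)) := by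
  rintro ⟨a, e⟩ ⟨b, f⟩ h
  cases h
  rfl

/-- `Quiver.Star x` as a subtype of the type of all oriented edges. -/
def starEquivEdgesFrom (x : V) : Quiver.Star x ≃ {e : Quiver.Total V // x = e.left} where
  toFun s := ⟨⟨x, s.1, s.2⟩, rfl⟩
  invFun e := ⟨e.1.right, e.1.hom.cast e.2.symm rfl⟩
  left_inv _ := rfl
  right_inv := by
    rintro ⟨e, h⟩
    cases h
    rfl

theorem RegularOfDegree.card_edges_from {d : ℕ} (hreg : RegularOfDegree V d) (x : V) :
    Nat.card {e : Quiver.Total V // x = e.left} = d :=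
  (Nat.card_congr (starEquivEdgesFrom x)).symm.trans (hreg x)

theorem RegularOfDegree.finite_star {d : ℕ} (hreg : RegularOfDegree V d) (hd : d ≠ 0) (x : V) :
    Finite (Quiver.Star x) :=
  Nat.finite_of_card_ne_zero (by rwa [hreg])

/-- The reversal of oriented edges. -/
def reverseEdge [Quiver.HasReverse V] (e : Quiver.Total V) : Quiver.Total V :=
  ⟨e.right, e.left, Quiver.reverse e.hom⟩

theorem reverseEdge_involutive [Quiver.HasInvolutiveReverse V] :
    Function.Involutive (reverseEdge (V := V)) := fun e => by
  simp [reverseEdge]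

end Edges

section ContinuationRule

variable [Quiver.HasInvolutiveReverse V] {R : Quiver.Total V → Quiver.Total V → Prop} {k : ℕ}

/-- `R e f` is a rule saying whether the edge `e` may be followed by the edge `f` in a path. It is
invariant under reversal of paths, leaves `k > 0` choices after every edge, and lets any two edges
with the same terminus be followed by a common edge. -/
structure IsContinuationRule (R : Quiver.Total V → Quiver.Total V → Prop) (k : ℕ) : Prop where
  pos : 0 < k
  right_eq_left : ∀ {e f}, R e f → e.right = f.left
  reverse : ∀ {e f}, R e f → R (reverseEdge f) (reverseEdge e)
  card_succ : ∀ e, Nat.card {f // R e f} = k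
  exists_common_succ : ∀ {e e'}, e.right = e'.right → ∃ f, R e f ∧ R e' f

namespace IsContinuationRule

theorem isBiregular (h : IsContinuationRule R k) : IsBiregular R k where
  pos := h.pos
  card_succ := h.card_succ
  card_pred f := by
    rw [← h.card_succ (reverseEdge f)]
    refine Nat.card_congr (reverseEdge_involutive.toPerm.subtypeEquiv fun e => ⟨h.reverse, ?_⟩)
    intro hfe
    simpa only [Function.Involutive.coe_toPerm, reverseEdge_involutive _] using h.reverse hfe

/-- If the edges into `b` lie in `S 0`, then an edge `b ⟶ c` lies in `S 1`. If they lie in `S 1`,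
then so does the reverse edge `c ⟶ b`, whose predecessors are edges into `c` that lie in `S 0`. -/
theorem mem_zero_or_mem_one (h : IsContinuationRule R k) (hconn : Connected V)
    {S : ℕ → Set (Quiver.Total V)} (hS : ∀ {e f}, R e f → ∀ j, e ∈ S j ↔ f ∈ S (j + 1))
    {e₀ : Quiver.Total V} (he₀ : e₀ ∈ S 0) (e : Quiver.Total V) : e ∈ S 0 ∨ e ∈ S 1 := by
  have mem_of_right_eq {e e' : Quiver.Total V} {j : ℕ} (hright : e.right = e'.right)
      (he : e ∈ S j) : e' ∈ S j := by
    obtain ⟨f, hef, hef'⟩ := h.exists_common_succ hright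
    exact (hS hef' j).2 ((hS hef j).1 he)
  obtain ⟨p⟩ := hconn e₀.right e.right
  generalize hy : e.right = y at p
  induction p generalizing e with
  | nil => exact .inl (mem_of_right_eq hy.symm he₀)
  | @cons b c _ i ih =>
    obtain ⟨e₁, he₁⟩ := h.isBiregular.exists_pred ⟨b, c, i⟩
    obtain ⟨e₂, he₂⟩ := h.isBiregular.exists_pred (reverseEdge ⟨b, c, i⟩)
    rcases ih e₁ (h.right_eq_left he₁) with hmem | hmem
    · exact .inr (mem_of_right_eq hy.symm ((hS he₁ 0).1 hmem))
    · have hrev : reverseEdge ⟨b, c, i⟩ ∈ S 1 := mem_of_right_eq (h.right_eq_left he₁) hmem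
      exact .inl (mem_of_right_eq ((h.right_eq_left he₂).trans hy.symm) ((hS he₂ 0).2 hrev))

theorem tendsto_iterate_predMean [Infinite V] (h : IsContinuationRule R k) (hconn : Connected V)
    {g : Quiver.Total V → ℝ} (hg : Summable fun e => g e ^ 2) (e₀ : Quiver.Total V) :
    Tendsto (fun n => (predMean R)^[n] g e₀) atTop (𝓝 0) := by
  set w : ℕ → Quiver.Total V → ℝ := fun n => (predMean R)^[n] g
  let S (j : ℕ) : Set (Quiver.Total V) :=
    {e | Tendsto (fun n => w n e₀ - w (n + j) e) atTop (𝓝 0)}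
  have hS {e f : Quiver.Total V} (hef : R e f) (j : ℕ) : e ∈ S j ↔ f ∈ S (j + 1) := by
    have hshift := (h.isBiregular.tendsto_iterate_predMean_sub hg hef).comp
      (tendsto_add_atTop_nat j)
    change Tendsto (fun n => w (n + j) e - w (n + j + 1) f) atTop (𝓝 0) at hshift
    exact ⟨fun he => by simpa [S, add_assoc] using Tendsto.add he hshift,
      fun hf => by simpa [S, add_assoc] using Tendsto.sub hf hshift⟩
  have hcover : S 0 ∪ S 1 = Set.univ := Set.eq_univ_of_forall
    (h.mem_zero_or_mem_one hconn hS (e₀ := e₀) (by simp [S]))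
  have hbound (j n : ℕ) (t : Finset (Quiver.Total V)) :
      ∑ e ∈ t, w (n + j) e ^ 2 ≤ ∑' e, g e ^ 2 :=
    ((h.isBiregular.summable_sq_iterate_predMean hg _).sum_le_tsum t
      fun _ _ => sq_nonneg _).trans
      (h.isBiregular.antitone_tsum_sq_iterate_predMean hg (Nat.zero_le (n + j)))
  have : Infinite (Quiver.Total V) := by
    refine Infinite.of_surjective Quiver.Total.right fun y => ?_
    obtain ⟨_ | ⟨p, i⟩⟩ := hconn e₀.right y
    exacts [⟨e₀, rfl⟩, ⟨⟨_, _, i⟩, rfl⟩]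
  rcases Set.infinite_union.1 (hcover ▸ Set.infinite_univ) with hinf | hinf
  · exact tendsto_zero_of_infinite_tendsto_sub (hbound 0) hinf
  · exact tendsto_zero_of_infinite_tendsto_sub (hbound 1) hinf

end IsContinuationRule

end ContinuationRule

section Counting

variable {x : V}

theorem ncard_length_eq_succ_le {y : V} [Fintype (Quiver.Costar y)] (P : Quiver.Path x y → Prop)
    (n : ℕ) : {p | P p ∧ p.length = n + 1}.ncard ≤
      ∑ s : Quiver.Costar y, {q : Quiver.Path x s.1 | P (q.cons s.2) ∧ q.length = n}.ncard := by
  have hset : {p | P p ∧ p.length = n + 1} = ⋃ s : Quiver.Costar y,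
      (fun q => q.cons s.2) '' {q : Quiver.Path x s.1 | P (q.cons s.2) ∧ q.length = n} := by
    ext p
    simp only [Set.mem_iUnion, Set.mem_image]
    constructor
    · rintro ⟨hP, hlength⟩
      cases p with
      | nil => simp at hlength
      | @cons a _ q i => exact ⟨⟨a, i⟩, q, ⟨hP, by simpa using hlength⟩, rfl⟩
    · rintro ⟨⟨a, i⟩, q, ⟨hP, hlength⟩, rfl⟩
      exact ⟨hP, by simpa using hlength⟩
  rw [hset]
  refine (Set.ncard_iUnion_le_of_fintype _).trans_eq (Finset.sum_congr rfl fun s _ => ?_)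
  exact Set.ncard_image_of_injective _ fun q q' h => by simpa using h

theorem ncard_length_le_le_sum {y : V} (P : Quiver.Path x y → Prop) (n : ℕ) :
    {p | P p ∧ p.length ≤ n}.ncard ≤
      ∑ i ∈ Finset.range (n + 1), {p | P p ∧ p.length = i}.ncard := by
  have hset : {p | P p ∧ p.length ≤ n} =
      ⋃ i ∈ Finset.range (n + 1), {p | P p ∧ p.length = i} := by
    ext p
    simp
  exact hset ▸ Finset.set_ncard_biUnion_le _ _

/-- Every two successive edges of the path are related by `R`. -/
def IsAdmissible (R : Quiver.Total V → Quiver.Total V → Prop) {x : V} :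
    ∀ {y : V}, Quiver.Path x y → Prop
  | _, .nil => True
  | _, .cons .nil _ => True
  | _, .cons (.cons p e) f => IsAdmissible R (.cons p e) ∧ R ⟨_, _, e⟩ ⟨_, _, f⟩

/-- The admissible paths from `x` of length `n + 1` with last edge `e`. They are encoded without
their last edge, as paths of length `n` from `x` to the origin of `e`. -/
def admissiblePathsTo (R : Quiver.Total V → Quiver.Total V → Prop) (x : V) (n : ℕ)
    (e : Quiver.Total V) : Set (Quiver.Path x e.left) :=
  {q | IsAdmissible R (q.cons e.hom) ∧ q.length = n}

/-- The indicator function of the edges with origin `x`. -/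
noncomputable def originIndicator (x : V) : Quiver.Total V → ℝ :=
  {e | x = e.left}.indicator 1

theorem summable_sq_originIndicator [Finite (Quiver.Star x)] :
    Summable fun e => originIndicator x e ^ 2 := by
  have hfinite : {e : Quiver.Total V | x = e.left}.Finite :=
    Finite.of_equiv _ (starEquivEdgesFrom x)
  refine summable_of_hasFiniteSupport (hfinite.subset fun e he => ?_)
  exact Set.mem_of_indicator_ne_zero (pow_ne_zero_iff two_ne_zero |>.1 he)

variable {R : Quiver.Total V → Quiver.Total V → Prop} {k : ℕ}

theorem ncard_admissiblePathsTo_zero_le (e : Quiver.Total V) :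
    ((admissiblePathsTo R x 0 e).ncard : ℝ) ≤ originIndicator x e := by
  obtain ⟨a, b, i⟩ := e
  by_cases hx : x = a
  · subst hx
    have hsub : admissiblePathsTo R x 0 ⟨x, b, i⟩ ⊆ {Quiver.Path.nil} := fun q hq =>
      q.eq_nil_of_length_zero hq.2
    have hcard := Set.ncard_le_ncard hsub
    simpa [originIndicator] using hcard
  · have hempty : admissiblePathsTo R x 0 ⟨a, b, i⟩ = ∅ :=
      Set.eq_empty_of_forall_notMem fun q hq => hx (q.eq_of_length_zero hq.2)
    simp [hempty, originIndicator, hx]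

theorem tsum_pred_eq_sum_costar (hR : ∀ {e f}, R e f → e.right = f.left) (g : Quiver.Total V → ℝ)
    (f : Quiver.Total V) [Fintype (Quiver.Costar f.left)] :
    ∑' e : {e // R e f}, g e =
      ∑ s : Quiver.Costar f.left, {e | R e f}.indicator g (costarEdge s) := by
  have hsupport : Function.support ({e | R e f}.indicator g) ⊆
      Set.range (costarEdge (y := f.left)) := by
    rintro ⟨a, b, i⟩ he
    have hef : R ⟨a, b, i⟩ f := Set.mem_of_indicator_ne_zero (s := {e | R e f}) he
    obtain rfl : b = f.left := hR hef
    exact ⟨⟨a, i⟩, rfl⟩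
  rw [← tsum_fintype (L := .unconditional _), (costarEdge_injective f.left).tsum_eq hsupport]
  exact tsum_subtype {e | R e f} g

theorem ncard_admissiblePathsTo_succ_le [∀ y : V, Finite (Quiver.Costar y)]
    (hR : ∀ {e f}, R e f → e.right = f.left) (n : ℕ) (f : Quiver.Total V) :
    ((admissiblePathsTo R x (n + 1) f).ncard : ℝ) ≤
      ∑' e : {e // R e f}, ((admissiblePathsTo R x n e).ncard : ℝ) := by
  have := Fintype.ofFinite (Quiver.Costar f.left)
  rw [tsum_pred_eq_sum_costar hR fun e => ((admissiblePathsTo R x n e).ncard : ℝ)]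
  refine (Nat.cast_le.2 (ncard_length_eq_succ_le _ n)).trans ?_
  rw [Nat.cast_sum]
  refine Finset.sum_le_sum fun s _ => ?_
  by_cases hs : R (costarEdge s) f
  · rw [Set.indicator_of_mem (s := {e | R e f}) hs]
    have hset : {q : Quiver.Path x s.1 | IsAdmissible R ((q.cons s.2).cons f.hom) ∧
        q.length = n} = admissiblePathsTo R x n (costarEdge s) :=
      Set.ext fun q => and_congr_left' (and_iff_left hs)
    exact hset ▸ le_rfl
  · rw [Set.indicator_of_notMem (s := {e | R e f}) hs]
    have hset : {q : Quiver.Path x s.1 | IsAdmissible R ((q.cons s.2).cons f.hom) ∧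
        q.length = n} = ∅ := Set.eq_empty_of_forall_notMem fun q hq => hs hq.1.2
    rw [hset, Set.ncard_empty, Nat.cast_zero]

theorem IsBiregular.ncard_admissiblePathsTo_le [∀ y : V, Finite (Quiver.Costar y)]
    (h : IsBiregular R k) (hR : ∀ {e f}, R e f → e.right = f.left) (n : ℕ) (f : Quiver.Total V) :
    ((admissiblePathsTo R x n f).ncard : ℝ) ≤
      k ^ n * (predMean R)^[n] (originIndicator x) f := by
  induction n generalizing f with
  | zero => simpa using ncard_admissiblePathsTo_zero_le f
  | succ n ih =>
    have := h.finite_pred f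
    calc ((admissiblePathsTo R x (n + 1) f).ncard : ℝ)
        ≤ ∑' e : {e // R e f}, ((admissiblePathsTo R x n e).ncard : ℝ) :=
          ncard_admissiblePathsTo_succ_le hR n f
      _ ≤ ∑' e : {e // R e f}, k ^ n * (predMean R)^[n] (originIndicator x) e :=
          Summable.of_finite.tsum_le_tsum (fun e => ih e) Summable.of_finite
      _ = k ^ (n + 1) * (predMean R)^[n + 1] (originIndicator x) f := by
          rw [tsum_mul_left, ← h.mul_predMean, Function.iterate_succ_apply', pow_succ, mul_assoc]

end Counting

section Asymptotics

variable [Quiver.HasInvolutiveReverse V] {R : Quiver.Total V → Quiver.Total V → Prop} {k : ℕ}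

namespace IsContinuationRule

theorem tendsto_card_length_eq_div_pow [Infinite V] [∀ x : V, Finite (Quiver.Star x)]
    (h : IsContinuationRule R k) (hconn : Connected V) (x y : V) :
    Tendsto (fun n => (Nat.card {p : Quiver.Path x y // IsAdmissible R p ∧ p.length = n} : ℝ) /
      (k : ℝ) ^ n) atTop (𝓝 0) := by
  have (z : V) : Finite (Quiver.Costar z) := Finite.of_equiv _ (Quiver.starEquivCostar z)
  have := Fintype.ofFinite (Quiver.Costar y)
  have hk : (0 : ℝ) < k := Nat.cast_pos.2 h.pos
  let w (n : ℕ) : Quiver.Total V → ℝ := (predMean R)^[n] (originIndicator x)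
  have hlim : Tendsto (fun n => (∑ s : Quiver.Costar y, w n (costarEdge s)) / k) atTop (𝓝 0) := by
    simpa using (tendsto_finsetSum Finset.univ fun (s : Quiver.Costar y) _ =>
      h.tendsto_iterate_predMean hconn summable_sq_originIndicator (costarEdge s)).div_const (k : ℝ)
  have hle (n : ℕ) : (Nat.card {p : Quiver.Path x y // IsAdmissible R p ∧ p.length = n + 1} : ℝ) ≤
      k ^ n * ∑ s : Quiver.Costar y, w n (costarEdge s) :=
    calc (Nat.card {p : Quiver.Path x y // IsAdmissible R p ∧ p.length = n + 1} : ℝ)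
        ≤ ∑ s : Quiver.Costar y, ((admissiblePathsTo R x n (costarEdge s)).ncard : ℝ) := by
          exact_mod_cast ncard_length_eq_succ_le (IsAdmissible R) n
      _ ≤ ∑ s : Quiver.Costar y, k ^ n * w n (costarEdge s) := Finset.sum_le_sum fun s _ =>
          h.isBiregular.ncard_admissiblePathsTo_le h.right_eq_left n (costarEdge s)
      _ = k ^ n * ∑ s : Quiver.Costar y, w n (costarEdge s) := (Finset.mul_sum ..).symm
  rw [← tendsto_add_atTop_iff_nat 1]
  refine squeeze_zero (fun n => by positivity) (fun n => ?_) hlim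
  rw [div_le_div_iff₀ (pow_pos hk _) hk, pow_succ, ← mul_assoc, mul_comm (∑ s, _)]
  exact mul_le_mul_of_nonneg_right (hle n) hk.le

theorem tendsto_card_length_le_div_pow [Infinite V] [∀ x : V, Finite (Quiver.Star x)]
    (h : IsContinuationRule R k) (hk : 1 < k) (hconn : Connected V) (x y : V) :
    Tendsto (fun n => (Nat.card {p : Quiver.Path x y // IsAdmissible R p ∧ p.length ≤ n} : ℝ) /
      (k : ℝ) ^ n) atTop (𝓝 0) := by
  refine squeeze_zero (fun n => by positivity) (fun n => ?_) (tendsto_sum_range_div_pow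
    (Nat.one_lt_cast.2 hk) (h.tendsto_card_length_eq_div_pow hconn x y))
  gcongr
  exact_mod_cast ncard_length_le_le_sum (IsAdmissible R) n

end IsContinuationRule

end Asymptotics

section Rules

/-- The edge `f` starts where the edge `e` ends. -/
def Composable (e f : Quiver.Total V) : Prop := e.right = f.left

/-- The edge `f` starts where the edge `e` ends and is not the reverse of `e`. -/
def NonBacktracking [Quiver.HasReverse V] (e f : Quiver.Total V) : Prop :=
  e.right = f.left ∧ f ≠ reverseEdge e

theorem isAdmissible_composable {x y : V} (p : Quiver.Path x y) : IsAdmissible Composable p := by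
  induction p with
  | nil => trivial
  | cons p e ih =>
    cases p with
    | nil => trivial
    | cons p e' => exact ⟨ih, rfl⟩

theorem isAdmissible_nonBacktracking_iff [Quiver.HasReverse V] {x y : V} (p : Quiver.Path x y) :
    IsAdmissible NonBacktracking p ↔ IsReducedPath p := by
  induction p with
  | nil => rfl
  | @cons b _ p f ih =>
    cases p with
    | nil => rfl
    | cons p e =>
      refine and_congr ih ((and_iff_right rfl).trans (not_congr ?_))
      exact Subtype.mk_eq_mk.symm.trans
        ((starEquivEdgesFrom b).injective.eq_iff (a := .mk f) (b := .mk (Quiver.reverse e)))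

variable [Quiver.HasInvolutiveReverse V] {d : ℕ}

theorem RegularOfDegree.isContinuationRule_composable (hreg : RegularOfDegree V d) (hd : 0 < d) :
    IsContinuationRule (V := V) Composable d where
  pos := hd
  right_eq_left := id
  reverse := Eq.symm
  card_succ e := hreg.card_edges_from e.right
  exists_common_succ {e e'} hright := by
    have : 0 < Nat.card {f : Quiver.Total V // e.right = f.left} :=
      (hreg.card_edges_from _).symm ▸ hd
    obtain ⟨f, hf⟩ := nonempty_subtype.1 (Nat.card_pos_iff.1 this).1
    exact ⟨f, hf, hright.symm.trans hf⟩

theorem RegularOfDegree.isContinuationRule_nonBacktracking (hreg : RegularOfDegree V d)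
    (hd : 3 ≤ d) : IsContinuationRule (V := V) NonBacktracking (d - 1) where
  pos := by lia
  right_eq_left := And.left
  reverse {e f} hef := ⟨hef.1.symm, fun h => hef.2 (h.trans (reverseEdge_involutive f)).symm⟩
  card_succ e := by
    have hmem : reverseEdge e ∈ {f : Quiver.Total V | e.right = f.left} := rfl
    rw [← hreg.card_edges_from e.right]
    exact Set.ncard_sdiff_singleton_of_mem hmem
  exists_common_succ {e e'} hright := by
    have hcard : ({reverseEdge e, reverseEdge e'} : Set (Quiver.Total V)).ncard <
        {f : Quiver.Total V | e.right = f.left}.ncard :=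
      calc _ ≤ 2 := (Set.ncard_insert_le _ _).trans_eq (by rw [Set.ncard_singleton])
        _ < d := hd
        _ = _ := (hreg.card_edges_from e.right).symm
    obtain ⟨f, hf, hne⟩ := Set.exists_mem_notMem_of_ncard_lt_ncard hcard
    rw [Set.mem_insert_iff, Set.mem_singleton_iff, not_or] at hne
    exact ⟨f, ⟨hf, hne.1⟩, hright.symm.trans hf, hne.2⟩

end Rules

theorem theorem5p7_general {V : Type*} [Quiver V] [Quiver.HasInvolutiveReverse V] [Infinite V]
    (hconn : Connected V) (d : ℕ) (hd : 3 ≤ d) (hreg : RegularOfDegree V d) (x y : V) :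
    (Tendsto (fun n : ℕ => (Nat.card {p : Quiver.Path x y // IsReducedPath p ∧ p.length = n} : ℝ) /
        ((d : ℝ) - 1) ^ n) atTop (𝓝 0) ∧
      Tendsto (fun n : ℕ => (Nat.card {p : Quiver.Path x y // p.length = n} : ℝ) /
        (d : ℝ) ^ n) atTop (𝓝 0)) ∧
    (Tendsto (fun n : ℕ => (Nat.card {p : Quiver.Path x y // IsReducedPath p ∧ p.length ≤ n} : ℝ) /
        ((d : ℝ) - 1) ^ n) atTop (𝓝 0) ∧
      Tendsto (fun n : ℕ => (Nat.card {p : Quiver.Path x y // p.length ≤ n} : ℝ) /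
        (d : ℝ) ^ n) atTop (𝓝 0)) := by
  have := hreg.finite_star (by lia)
  have hreduced := hreg.isContinuationRule_nonBacktracking hd
  have hall := hreg.isContinuationRule_composable (by lia)
  have hcast : ((d - 1 : ℕ) : ℝ) = (d : ℝ) - 1 := by rw [Nat.cast_sub (by lia), Nat.cast_one]
  refine ⟨⟨?_, ?_⟩, ?_, ?_⟩
  · simpa only [isAdmissible_nonBacktracking_iff, hcast] using
      hreduced.tendsto_card_length_eq_div_pow hconn x y
  · simpa only [isAdmissible_composable, true_and] using
      hall.tendsto_card_length_eq_div_pow hconn x y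
  · simpa only [isAdmissible_nonBacktracking_iff, hcast] using
      hreduced.tendsto_card_length_le_div_pow (by lia) hconn x y
  · simpa only [isAdmissible_composable, true_and] using
      hall.tendsto_card_length_le_div_pow (by lia) hconn x y

end GraphPaths

theorem theorem5p7 {V : Type*} [Quiver V] [Quiver.HasInvolutiveReverse V] [Infinite V]
    (hconn : GraphPaths.Connected V) (d : ℕ) (hd : 3 ≤ d)
    (hreg : GraphPaths.RegularOfDegree V d) (x₀ : V) :
    (Filter.Tendsto (fun n : ℕ => (GraphPaths.numReducedClosed x₀ n : ℝ) / ((d : ℝ) - 1) ^ n)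
        Filter.atTop (nhds 0) ∧
      Filter.Tendsto (fun n : ℕ => (GraphPaths.numClosed x₀ n : ℝ) / (d : ℝ) ^ n)
        Filter.atTop (nhds 0)) ∧
    (Filter.Tendsto (fun n : ℕ => (GraphPaths.numReducedClosedLE x₀ n : ℝ) / ((d : ℝ) - 1) ^ n)
        Filter.atTop (nhds 0) ∧
      Filter.Tendsto (fun n : ℕ => (GraphPaths.numClosedLE x₀ n : ℝ) / (d : ℝ) ^ n)
        Filter.atTop (nhds 0)) :=
  GraphPaths.theorem5p7_general hconn d hd hreg x₀ x₀
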